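/- Let $n\ge 1$ and let $a_1,\dots,a_n$ be annihilation operators on a finite-dimensional complex Hilbert space $\mathcal H$, with adjoints $a_i^\dagger$, that satisfy the canonical anticommutation relations $\{a_i^\dagger,a_j\}=\delta_{ij}\mathbb 1$, $\{a_i^\dagger,a_j^\dagger\}=0$ and have a vacuum, that is, a unit vector $|0\rangle$, unique up to a scalar, with $a_i|0\rangle=0$ for all $i$. Let the reduced metric $M$ be a Hermitian positive-definite $n\times n$ complex matrix, and let the total (second-quantized) metric $\eta$ be the unique linear operator on $\mathcal H$ with $\eta a_i^\dagger=\sum_j M_{ji}a_j^\dagger\eta$ for all $i$ and $\eta|0\rangle=|0\rangle$. An operator $O$ on $\mathcal H$ is a quasi-Hermitian observable if $\eta O=O^\dagger\eta$. It is (Bravyi-Kitaev) local to a set of sites $S\subseteq\{1,\dots,n\}$ if it lies in the linear span of the products $\bigl(\prod_{k\in A}a_k^\dagger\bigr)\bigl(\prod_{l\in B}a_l\bigr)$ with $A,B\subseteq S$ and $|A|+|B|$ even, and extensively local over $S$ if in addition it is not local to any proper subset of $S$. For every site $i$, there exists a quasi-Hermitian observable that is extensively local over $\{i\}$ if and only if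 $M_{ij}=M_{ji}=0$ for all $j\neq i$. -/

import Mathlib

/-- A realization of the canonical anticommutation relations for `n` fermionic modes (sites) on a
finite-dimensional Hilbert space `H`, with a unique vacuum. The creation operators are the adjoints
of the annihilation operators with respect to the inner product of `H`. -/
structure FermionRep (n : ℕ) (H : Type*) [NormedAddCommGroup H] [InnerProductSpace ℂ H]
    [FiniteDimensional ℂ H] where
  /-- the annihilation operators -/
  a : Fin n → Module.End ℂ H
  /-- `{aᵢ†, aⱼ} = δᵢⱼ 1` -/
  anticomm_adjoint : ∀ i j,
    LinearMap.adjoint (a i) * a j + a j * LinearMap.adjoint (a i) = if i = j then 1 else 0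
  /-- `{aᵢ†, aⱼ†} = 0` -/
  anticomm : ∀ i j, LinearMap.adjoint (a i) * LinearMap.adjoint (a j) +
    LinearMap.adjoint (a j) * LinearMap.adjoint (a i) = 0
  /-- the vacuum state -/
  vac : H
  norm_vac : ‖vac‖ = 1
  a_vac : ∀ i, a i vac = 0
  /-- the vacuum is unique up to a scalar -/
  vac_unique : ∀ ψ : H, (∀ i, a i ψ = 0) → ∃ c : ℂ, ψ = c • vac

namespace FermionRep

variable {n : ℕ} {H : Type*} [NormedAddCommGroup H] [InnerProductSpace ℂ H]
  [FiniteDimensional ℂ H]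

/-- The creation operator `aᵢ†`. -/
noncomputable def adag (F : FermionRep n H) (i : Fin n) : Module.End ℂ H :=
  LinearMap.adjoint (F.a i)

/-- The product `(∏_{i ∈ A} aᵢ†) (∏_{j ∈ B} aⱼ)`, both products taken in increasing order of the
sites (another order changes it only by a sign). -/
noncomputable def monomial (F : FermionRep n H) (A B : Finset (Fin n)) : Module.End ℂ H :=
  ((A.sort (· ≤ ·)).map F.adag).prod * ((B.sort (· ≤ ·)).map F.a).prod

/-- The operators that are (Bravyi-Kitaev) local to the set of sites `S`: the linear combinations of
even products of creation and annihilation operators with indices in `S`. -/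
noncomputable def localOps (F : FermionRep n H) (S : Finset (Fin n)) :
    Submodule ℂ (Module.End ℂ H) :=
  Submodule.span ℂ
    {X | ∃ A B : Finset (Fin n), A ⊆ S ∧ B ⊆ S ∧ Even (A.card + B.card) ∧ X = F.monomial A B}

/-- `O` is extensively local over `S`: it is local to `S`, and to no proper subset of `S`. -/
def IsExtensivelyLocal (F : FermionRep n H) (S : Finset (Fin n)) (O : Module.End ℂ H) : Prop :=
  O ∈ F.localOps S ∧ ∀ S₁ : Finset (Fin n), S₁ ⊂ S → O ∉ F.localOps S₁

/-- The operator equations that define the total (second-quantized) metric of a reduced metric `M`: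
`η aᵢ† = ∑ⱼ Mⱼᵢ aⱼ† η` and `η |0⟩ = |0⟩`. -/
def IsTotalMetric (F : FermionRep n H) (M : Matrix (Fin n) (Fin n) ℂ) (η : Module.End ℂ H) : Prop :=
  (∀ i, η * F.adag i = ∑ j, M j i • (F.adag j * η)) ∧ η F.vac = F.vac

/-! ### The total metric exists and is unique -/

section Existence

open ExteriorAlgebra CliffordAlgebra

/-- The smeared creation operator `a†(g) = ∑ᵢ gᵢ aᵢ†`. -/
noncomputable def adagMap (F : FermionRep n H) : (Fin n → ℂ) →ₗ[ℂ] Module.End ℂ H :=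
  Fintype.linearCombination ℂ F.adag

lemma adagMap_apply (F : FermionRep n H) (g : Fin n → ℂ) :
    F.adagMap g = ∑ i, g i • F.adag i := rfl

lemma adagMap_sq (F : FermionRep n H) (g : Fin n → ℂ) : F.adagMap g * F.adagMap g = 0 := by
  have h : F.adagMap g * F.adagMap g + F.adagMap g * F.adagMap g = 0 := by
    have e1 : F.adagMap g * F.adagMap g
        = ∑ i, ∑ j, (g i * g j) • (F.adag i * F.adag j) := by
      rw [adagMap_apply, Finset.sum_mul_sum]
      simp [smul_smul, mul_comm]
    have e2 : F.adagMap g * F.adagMap g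
        = ∑ i, ∑ j, (g i * g j) • (F.adag j * F.adag i) := by
      rw [e1, Finset.sum_comm]
      simp [mul_comm]
    nth_rewrite 1 [e1]
    rw [e2]
    simp only [← Finset.sum_add_distrib, ← smul_add]
    refine Finset.sum_eq_zero fun i _ => Finset.sum_eq_zero fun j _ => ?_
    have := F.anticomm i j
    simp only [adag]
    rw [this, smul_zero]
  have h2 : (2 : ℂ) • (F.adagMap g * F.adagMap g) = 0 := by rw [two_smul]; exact h
  exact (smul_eq_zero.mp h2).resolve_left two_ne_zero

/-- The action of the exterior algebra on the vacuum through the creation operators. -/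
noncomputable def fockMap (F : FermionRep n H) : ExteriorAlgebra ℂ (Fin n → ℂ) →ₗ[ℂ] H :=
  LinearMap.applyₗ F.vac ∘ₗ (ExteriorAlgebra.lift ℂ ⟨F.adagMap, F.adagMap_sq⟩).toLinearMap

lemma fockMap_one (F : FermionRep n H) : F.fockMap 1 = F.vac := by
  simp [fockMap]

lemma fockMap_ι_mul (F : FermionRep n H) (v : Fin n → ℂ) (x : ExteriorAlgebra ℂ (Fin n → ℂ)) :
    F.fockMap (ExteriorAlgebra.ι ℂ v * x) = F.adagMap v (F.fockMap x) := by
  simp [fockMap, ExteriorAlgebra.lift_ι_apply]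

lemma ext_induction {C : ExteriorAlgebra ℂ (Fin n → ℂ) → Prop} (one : C 1)
    (smul : ∀ (c : ℂ) x, C x → C (c • x)) (add : ∀ x y, C x → C y → C (x + y))
    (mul : ∀ v x, C x → C (ExteriorAlgebra.ι ℂ v * x)) (x) : C x := by
  refine CliffordAlgebra.left_induction (Q := (0 : QuadraticForm ℂ (Fin n → ℂ))) ?_ ?_ ?_ x
  · intro r
    rw [Algebra.algebraMap_eq_smul_one]
    exact smul r 1 one
  · intro x y hx hy; exact add x y hx hy
  · intro x m hx; exact mul m x hx

/-- Interior multiplication by the `i`-th coordinate. -/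
noncomputable def contr (i : Fin n) :
    ExteriorAlgebra ℂ (Fin n → ℂ) →ₗ[ℂ] ExteriorAlgebra ℂ (Fin n → ℂ) :=
  CliffordAlgebra.contractLeft (Q := (0 : QuadraticForm ℂ (Fin n → ℂ))) (LinearMap.proj i)

lemma contr_one (i : Fin n) : contr i 1 = 0 :=
  CliffordAlgebra.contractLeft_one (Q := (0 : QuadraticForm ℂ (Fin n → ℂ))) _

lemma contr_ι_mul (i : Fin n) (v : Fin n → ℂ) (x) :
    contr i (ExteriorAlgebra.ι ℂ v * x) = v i • x - ExteriorAlgebra.ι ℂ v * contr i x :=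
  CliffordAlgebra.contractLeft_ι_mul (Q := (0 : QuadraticForm ℂ (Fin n → ℂ))) _ v x

lemma a_adagMap (F : FermionRep n H) (i : Fin n) (v : Fin n → ℂ) (ψ : H) :
    F.a i (F.adagMap v ψ) = v i • ψ - F.adagMap v (F.a i ψ) := by
  have h : F.a i * F.adagMap v + F.adagMap v * F.a i = v i • (1 : Module.End ℂ H) := by
    rw [adagMap_apply, Finset.mul_sum, Finset.sum_mul, ← Finset.sum_add_distrib]
    simp only [mul_smul_comm, smul_mul_assoc, ← smul_add]
    rw [Finset.sum_eq_single i]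
    · have := F.anticomm_adjoint i i
      rw [add_comm, if_pos rfl] at this
      rw [adag, this]
    · intro j _ hj
      have := F.anticomm_adjoint j i
      rw [add_comm, if_neg hj] at this
      rw [adag, this, smul_zero]
    · simp
  have := congrArg (fun T : Module.End ℂ H => T ψ) h
  simp only [LinearMap.add_apply, Module.End.mul_apply, LinearMap.smul_apply,
    Module.End.one_apply] at this
  rw [← this]; abel

lemma a_fockMap (F : FermionRep n H) (i : Fin n) (x) :
    F.a i (F.fockMap x) = F.fockMap (contr i x) := by
  induction x using ext_induction with
  | one => rw [contr_one, fockMap_one, F.a_vac, map_zero]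
  | smul c x hx => simp [hx]
  | add x y hx hy => simp [hx, hy]
  | mul v x hx => rw [fockMap_ι_mul, a_adagMap, contr_ι_mul, hx, map_sub, map_smul, fockMap_ι_mul]

/-- A nonzero vector of a space with anticommuting square-zero operators can be lowered to a nonzero
vector that all of them annihilate. -/
lemma exists_lowest {E : Type*} [AddCommGroup E] [Module ℂ E] (d : Fin n → E →ₗ[ℂ] E)
    (hd : ∀ i j x, d i (d j x) = -d j (d i x)) (K : Submodule ℂ E)
    (hK : ∀ i, ∀ x ∈ K, d i x ∈ K) {x : E} (hx : x ∈ K) (hx0 : x ≠ 0) :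
    ∃ y ∈ K, y ≠ 0 ∧ ∀ i, d i y = 0 := by
  have key : ∀ s : Finset (Fin n), ∃ y ∈ K, y ≠ 0 ∧ ∀ i ∈ s, d i y = 0 := by
    intro s
    induction s using Finset.induction_on with
    | empty => exact ⟨x, hx, hx0, by simp⟩
    | insert j s _ ih =>
      obtain ⟨y, hy, hy0, h⟩ := ih
      by_cases hj : d j y = 0
      · refine ⟨y, hy, hy0, fun i hi => ?_⟩
        rcases Finset.mem_insert.mp hi with rfl | hi
        · exact hj
        · exact h i hi
      · refine ⟨d j y, hK j y hy, hj, fun i hi => ?_⟩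
        rcases Finset.mem_insert.mp hi with rfl | hi
        · have h2 : (2 : ℂ) • d i (d i y) = 0 := by
            rw [two_smul]; nth_rewrite 1 [hd i i y]; exact neg_add_cancel _
          exact (smul_eq_zero.mp h2).resolve_left two_ne_zero
        · rw [hd, h i hi, map_zero, neg_zero]
  obtain ⟨y, h1, h2, h3⟩ := key Finset.univ
  exact ⟨y, h1, h2, fun i => h3 i (Finset.mem_univ i)⟩

lemma contr_contr (i j : Fin n) (x) : contr i (contr j x) = -contr j (contr i x) :=
  CliffordAlgebra.contractLeft_comm (Q := (0 : QuadraticForm ℂ (Fin n → ℂ))) _ _ x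

/-- An element of the exterior algebra that every contraction annihilates is a scalar. -/
lemma scalar_of_contr_eq_zero {x : ExteriorAlgebra ℂ (Fin n → ℂ)} (hx : ∀ i, contr i x = 0) :
    ∃ c : ℂ, x = c • 1 := by
  let e : Fin n → ExteriorAlgebra ℂ (Fin n → ℂ) := fun i => ExteriorAlgebra.ι ℂ (Pi.single i 1)
  let P : List (Fin n) → ExteriorAlgebra ℂ (Fin n → ℂ) → ExteriorAlgebra ℂ (Fin n → ℂ) :=
    fun l y => l.foldr (fun i z => contr i (e i * z)) y
  have P_fix : ∀ l y, (∀ i, contr i y = 0) → P l y = y := by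
    intro l y hy
    induction l with
    | nil => rfl
    | cons i l ih =>
      change contr i (e i * P l y) = y
      rw [ih, contr_ι_mul, hy i]
      simp
  have P_add : ∀ l y z, P l (y + z) = P l y + P l z := by
    intro l y z
    induction l with
    | nil => rfl
    | cons i l ih =>
      change contr i (e i * P l (y + z)) = contr i (e i * P l y) + contr i (e i * P l z)
      rw [ih, mul_add, map_add]
  have P_smul : ∀ l (c : ℂ) y, P l (c • y) = c • P l y := by
    intro l c y
    induction l with
    | nil => rfl
    | cons i l ih =>
      change contr i (e i * P l (c • y)) = c • contr i (e i * P l y)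
      rw [ih, mul_smul_comm, map_smul]
  have P_zero : ∀ l, P l 0 = 0 := fun l => by simpa using P_smul l 0 0
  have sq : ∀ i, e i * e i = 0 := fun i => ExteriorAlgebra.ι_sq_zero _
  have swap : ∀ i j, e i * e j = -(e j * e i) := fun i j =>
    eq_neg_of_add_eq_zero_left (ExteriorAlgebra.ι_add_mul_swap _ _)
  have P_e : ∀ l j z, (j ∈ l → P l (e j * z) = 0) ∧ (j ∉ l → P l (e j * z) = e j * P l z) := by
    intro l j z
    induction l with
    | nil => exact ⟨by simp, fun _ => rfl⟩
    | cons i l ih =>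
      have hcons : ∀ y, P (i :: l) y = contr i (e i * P l y) := fun _ => rfl
      by_cases hjl : j ∈ l
      · refine ⟨fun _ => ?_, fun h => absurd (List.mem_cons_of_mem i hjl) h⟩
        rw [hcons, ih.1 hjl, mul_zero, map_zero]
      · by_cases hij : j = i
        · subst hij
          refine ⟨fun _ => ?_, fun h => absurd List.mem_cons_self h⟩
          rw [hcons, ih.2 hjl, ← mul_assoc, sq, zero_mul, map_zero]
        · refine ⟨fun h => absurd h (by simp [hij, hjl]), fun _ => ?_⟩
          rw [hcons, hcons, ih.2 hjl, ← mul_assoc, swap i j, neg_mul, mul_assoc, map_neg,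
            contr_ι_mul]
          simp [e, Ne.symm hij]
  have P_scalar : ∀ y, ∃ c : ℂ, P (Finset.univ : Finset (Fin n)).toList y = c • 1 := by
    intro y
    induction y using ext_induction with
    | one => exact ⟨1, by rw [one_smul]; exact P_fix _ _ contr_one⟩
    | smul c x hx => obtain ⟨d, hd⟩ := hx; exact ⟨c * d, by rw [P_smul, hd, smul_smul]⟩
    | add x y hx hy =>
      obtain ⟨d, hd⟩ := hx
      obtain ⟨d', hd'⟩ := hy
      exact ⟨d + d', by rw [P_add, hd, hd', add_smul]⟩
    | mul v x _ =>
      refine ⟨0, ?_⟩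
      have hv : ExteriorAlgebra.ι ℂ v * x = ∑ i, v i • (e i * x) := by
        conv_lhs => rw [pi_eq_sum_univ' v]
        simp [Finset.sum_mul, e]
      let PL : ExteriorAlgebra ℂ (Fin n → ℂ) →ₗ[ℂ] ExteriorAlgebra ℂ (Fin n → ℂ) :=
        { toFun := P (Finset.univ : Finset (Fin n)).toList
          map_add' := P_add _
          map_smul' := P_smul _ }
      change PL _ = _
      rw [hv, map_sum, zero_smul]
      refine Finset.sum_eq_zero fun i _ => ?_
      rw [map_smul]
      have : PL (e i * x) = 0 := (P_e _ i x).1 (by simp)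
      rw [this, smul_zero]
  obtain ⟨c, hc⟩ := P_scalar x
  exact ⟨c, by rw [← hc, P_fix _ _ hx]⟩

lemma vac_ne_zero (F : FermionRep n H) : F.vac ≠ 0 := by
  intro h
  have := F.norm_vac
  simp [h] at this

lemma fockMap_injective (F : FermionRep n H) : Function.Injective F.fockMap := by
  rw [← LinearMap.ker_eq_bot, Submodule.eq_bot_iff]
  intro x hx
  by_contra hx0
  obtain ⟨y, hy, hy0, h⟩ := exists_lowest (fun i => contr i) contr_contr (LinearMap.ker F.fockMap)
    (fun i x hx => by rw [LinearMap.mem_ker, ← a_fockMap, LinearMap.mem_ker.mp hx, map_zero]) hx hx0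
  obtain ⟨c, rfl⟩ := scalar_of_contr_eq_zero h
  rw [LinearMap.mem_ker, map_smul, fockMap_one] at hy
  rcases smul_eq_zero.mp hy with rfl | hv
  · exact hy0 (zero_smul _ _)
  · exact F.vac_ne_zero hv

lemma a_a (F : FermionRep n H) (i j : Fin n) (x : H) : F.a i (F.a j x) = -F.a j (F.a i x) := by
  have h : F.a j * F.a i + F.a i * F.a j = 0 := by
    have := congrArg star (F.anticomm i j)
    simpa [LinearMap.star_eq_adjoint, ← LinearMap.star_eq_adjoint] using this
  have := congrArg (fun T : Module.End ℂ H => T x) h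
  simp only [LinearMap.add_apply, Module.End.mul_apply, LinearMap.zero_apply] at this
  exact eq_neg_of_add_eq_zero_right this

lemma adagMap_single (F : FermionRep n H) (i : Fin n) : F.adagMap (Pi.single i 1) = F.adag i := by
  simp [adagMap_apply, Pi.single_apply]

lemma fockMap_surjective (F : FermionRep n H) : Function.Surjective F.fockMap := by
  rw [← LinearMap.range_eq_top, ← Submodule.orthogonal_eq_bot_iff, Submodule.eq_bot_iff]
  intro x hx
  by_contra hx0
  obtain ⟨y, hy, hy0, h⟩ := exists_lowest F.a F.a_a (LinearMap.range F.fockMap)ᗮ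
    (fun i x hx => by
      rw [Submodule.mem_orthogonal] at hx ⊢
      rintro _ ⟨z, rfl⟩
      rw [← LinearMap.adjoint_inner_left]
      refine hx _ ⟨ExteriorAlgebra.ι ℂ (Pi.single i 1) * z, ?_⟩
      rw [fockMap_ι_mul, adagMap_single, adag]) hx hx0
  obtain ⟨c, rfl⟩ := F.vac_unique y h
  have : inner ℂ F.vac (c • F.vac) = 0 := (Submodule.mem_orthogonal _ _).mp hy _ ⟨1, F.fockMap_one⟩
  rw [inner_smul_right, inner_self_eq_norm_sq_to_K, F.norm_vac] at this
  have hc : c = 0 := by simpa using this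
  exact hy0 (by rw [hc, zero_smul])

/-- The defining equations of the total metric have exactly one solution. -/
theorem existsUnique_isTotalMetric (F : FermionRep n H) (M : Matrix (Fin n) (Fin n) ℂ) :
    ∃! η : Module.End ℂ H, F.IsTotalMetric M η := by
  let Φ : ExteriorAlgebra ℂ (Fin n → ℂ) ≃ₗ[ℂ] H :=
    LinearEquiv.ofBijective F.fockMap ⟨F.fockMap_injective, F.fockMap_surjective⟩
  have hΦ : ∀ x, Φ x = F.fockMap x := fun _ => rfl
  have hcol : ∀ i, F.adagMap (M.mulVecLin (Pi.single i 1)) = ∑ j, M j i • F.adag j := by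
    intro i
    simp [adagMap_apply]
  refine ⟨Φ.toLinearMap ∘ₗ (ExteriorAlgebra.map M.mulVecLin).toLinearMap ∘ₗ Φ.symm.toLinearMap,
    ⟨fun i => ?_, ?_⟩, fun η hη => ?_⟩
  · ext ψ
    obtain ⟨x, rfl⟩ := Φ.surjective ψ
    have h1 : F.adag i (Φ x) = Φ (ExteriorAlgebra.ι ℂ (Pi.single i 1) * x) := by
      rw [hΦ, hΦ, fockMap_ι_mul, adagMap_single]
    rw [Module.End.mul_apply, h1]
    simp only [LinearMap.comp_apply, LinearEquiv.coe_coe, LinearEquiv.symm_apply_apply,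
      AlgHom.toLinearMap_apply, map_mul, ExteriorAlgebra.map_apply_ι]
    rw [hΦ, fockMap_ι_mul, hcol]
    simp only [LinearMap.sum_apply, LinearMap.smul_apply, Module.End.mul_apply,
      LinearMap.comp_apply, LinearEquiv.coe_coe, AlgHom.toLinearMap_apply, hΦ]
    simp only [← hΦ, LinearEquiv.symm_apply_apply]
  · have h1 : F.vac = Φ 1 := F.fockMap_one.symm
    simp [h1]
  · ext ψ
    obtain ⟨x, rfl⟩ := Φ.surjective ψ
    simp only [LinearMap.comp_apply, LinearEquiv.coe_coe, LinearEquiv.symm_apply_apply,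
      AlgHom.toLinearMap_apply]
    induction x using ext_induction with
    | one => rw [map_one (ExteriorAlgebra.map M.mulVecLin), hΦ, fockMap_one, hη.2]
    | smul c x hx => simp [hx]
    | add x y hx hy => simp [hx, hy]
    | mul v x hx =>
      have hv : η * F.adagMap v = F.adagMap (M.mulVecLin v) * η := by
        have hl : LinearMap.mulLeft ℂ η ∘ₗ F.adagMap
            = LinearMap.mulRight ℂ η ∘ₗ F.adagMap ∘ₗ M.mulVecLin := by
          refine LinearMap.pi_ext' fun i => LinearMap.ext_ring ?_
          simp only [LinearMap.comp_apply, LinearMap.single_apply, LinearMap.mulLeft_apply,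
            LinearMap.mulRight_apply]
          rw [hcol, adagMap_single, hη.1, Finset.sum_mul]
          simp only [smul_mul_assoc]
        exact LinearMap.congr_fun hl v
      have := congrArg (fun T : Module.End ℂ H => T (Φ x)) hv
      simp only [Module.End.mul_apply] at this
      rw [hx] at this
      simpa [hΦ, fockMap_ι_mul] using this

end Existence

/-- The total (second-quantized) metric of the reduced metric `M`: the unique solution `η` of
`η aᵢ† = ∑ⱼ Mⱼᵢ aⱼ† η`, `η |0⟩ = |0⟩`. -/
noncomputable def totalMetric (F : FermionRep n H) (M : Matrix (Fin n) (Fin n) ℂ) :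
    Module.End ℂ H :=
  (F.existsUnique_isTotalMetric M).choose

theorem isTotalMetric_totalMetric (F : FermionRep n H) (M : Matrix (Fin n) (Fin n) ℂ) :
    F.IsTotalMetric M (F.totalMetric M) :=
  (F.existsUnique_isTotalMetric M).choose_spec.1

end FermionRep

/-- `O` is a quasi-Hermitian observable with respect to the metric `η`: `η O = O† η`. -/
def IsQuasiHermitian {H : Type*} [NormedAddCommGroup H] [InnerProductSpace ℂ H]
    [FiniteDimensional ℂ H] (η O : Module.End ℂ H) : Prop :=
  η * O = LinearMap.adjoint O * η

/- The order of `ℂ` that positive definiteness of complex matrices refers to. -/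
open scoped ComplexOrder

namespace FermionRep

variable {n : ℕ} {H : Type*} [NormedAddCommGroup H] [InnerProductSpace ℂ H]
  [FiniteDimensional ℂ H]

/-! By parity, the operators local to `{i}` are exactly the combinations `α + β nᵢ` of the identity
and the number operator `nᵢ = aᵢ† aᵢ`; extensive locality means `β ≠ 0`.

Necessity (`IsTotalMetric.column_eq_zero`): the metric sends `aᵢ†|0⟩` to `∑ⱼ Mⱼᵢ aⱼ†|0⟩`. On the
vacuum, quasi-Hermiticity makes `α` real. On `aᵢ†|0⟩`, its component along `aⱼ†|0⟩` with `j ≠ i`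
reads `(α + β) Mⱼᵢ = α Mⱼᵢ`, so `Mⱼᵢ = 0`, and `Mᵢⱼ = 0` since `M` is Hermitian.

Sufficiency (`IsTotalMetric.commute_number`): if site `i` is decoupled, `η` preserves its occupation
number, so the self-adjoint, non-scalar operator `nᵢ` is a witness. -/

lemma a_adag_apply (F : FermionRep n H) (i j : Fin n) (ψ : H) :
    F.a i (F.adag j ψ) = (if i = j then ψ else 0) - F.adag j (F.a i ψ) := by
  have h := F.a_adagMap i (Pi.single j 1) ψ
  rw [adagMap_single] at h
  rw [h]
  by_cases hij : i = j <;> simp [hij]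

lemma adag_adag_apply (F : FermionRep n H) (i j : Fin n) (ψ : H) :
    F.adag i (F.adag j ψ) = -F.adag j (F.adag i ψ) :=
  eq_neg_of_add_eq_zero_left (LinearMap.congr_fun (F.anticomm i j) ψ)

/-- The occupation number operator `nᵢ = aᵢ† aᵢ`. -/
noncomputable def number (F : FermionRep n H) (i : Fin n) : Module.End ℂ H :=
  F.adag i * F.a i

lemma number_apply (F : FermionRep n H) (i : Fin n) (ψ : H) :
    F.number i ψ = F.adag i (F.a i ψ) := rfl

lemma number_vac (F : FermionRep n H) (i : Fin n) : F.number i F.vac = 0 := by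
  rw [number_apply, F.a_vac, map_zero]

lemma adjoint_number (F : FermionRep n H) (i : Fin n) :
    LinearMap.adjoint (F.number i) = F.number i := by
  rw [number, adag, Module.End.mul_eq_comp, LinearMap.adjoint_comp, LinearMap.adjoint_adjoint]

lemma number_adag_apply (F : FermionRep n H) (i k : Fin n) (ψ : H) :
    F.number i (F.adag k ψ) = F.adag k (F.number i ψ) + if i = k then F.adag i ψ else 0 := by
  rw [number_apply, number_apply, a_adag_apply, map_sub, F.adag_adag_apply i k]
  by_cases h : i = k <;> simp [h, add_comm]

/-- The signs from moving `aⱼ` past `aᵢ†` and past `aᵢ` cancel. -/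
lemma a_number_apply_of_ne (F : FermionRep n H) {i j : Fin n} (hj : j ≠ i) (ψ : H) :
    F.a j (F.number i ψ) = F.number i (F.a j ψ) := by
  rw [number_apply, number_apply, a_adag_apply, if_neg hj, F.a_a j i, map_neg, zero_sub, neg_neg]

/-- A property that holds for the vacuum and is stable under linear combinations and creation
operators holds on the whole space. -/
lemma fock_induction (F : FermionRep n H) (K : Submodule ℂ H) (vac : F.vac ∈ K)
    (adag : ∀ i, ∀ ψ ∈ K, F.adag i ψ ∈ K) (ψ : H) : ψ ∈ K := by
  obtain ⟨x, rfl⟩ := F.fockMap_surjective ψ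
  induction x using ext_induction with
  | one => rwa [fockMap_one]
  | smul c x hx => rw [map_smul]; exact K.smul_mem c hx
  | add x y hx hy => rw [map_add]; exact K.add_mem hx hy
  | mul v x hx =>
    rw [fockMap_ι_mul, adagMap_apply, LinearMap.sum_apply]
    exact K.sum_mem fun i _ => K.smul_mem _ (adag i _ hx)

/-! ### The total metric and occupation numbers -/

lemma IsTotalMetric.adag_apply {F : FermionRep n H} {M : Matrix (Fin n) (Fin n) ℂ}
    {η : Module.End ℂ H} (h : F.IsTotalMetric M η) (i : Fin n) (ψ : H) :
    η (F.adag i ψ) = ∑ j, M j i • F.adag j (η ψ) := by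
  simpa using LinearMap.congr_fun (h.1 i) ψ

/-- If the site `i` is decoupled in the reduced metric, the total metric commutes with `nᵢ`. -/
lemma IsTotalMetric.commute_number {F : FermionRep n H} {M : Matrix (Fin n) (Fin n) ℂ}
    {η : Module.End ℂ H} (h : F.IsTotalMetric M η) {i : Fin n}
    (hM : ∀ j, j ≠ i → M i j = 0 ∧ M j i = 0) : η * F.number i = F.number i * η := by
  suffices H : ∀ ψ, ψ ∈ LinearMap.ker (η * F.number i - F.number i * η) by
    ext ψ
    exact sub_eq_zero.mp (H ψ)
  refine F.fock_induction _ ?_ fun k ψ hψ => ?_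
  · simp [number_vac, h.2]
  · have hψ' : η (F.number i ψ) = F.number i (η ψ) := sub_eq_zero.mp hψ
    change η (F.number i (F.adag k ψ)) - F.number i (η (F.adag k ψ)) = 0
    rw [sub_eq_zero, number_adag_apply, map_add, h.adag_apply, h.adag_apply, map_sum, hψ']
    simp only [map_smul, number_adag_apply, smul_add, Finset.sum_add_distrib]
    -- Both sides contain `∑ⱼ Mⱼₖ aⱼ† nᵢ η ψ`. What remains comes from the commutators `[nᵢ, aₖ†]`
    -- on the left and `[nᵢ, aⱼ†]` on the right, where only `Mᵢₖ aᵢ† η ψ` survives. The case `k = i`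
    -- uses the zeros in column `i` of `M`, the case `k ≠ i` those in row `i`.
    congr 1
    simp only [smul_ite, smul_zero, Finset.sum_ite_eq, Finset.mem_univ, if_true]
    by_cases hik : i = k
    · subst hik
      rw [if_pos rfl, h.adag_apply]
      exact Finset.sum_eq_single i (fun j _ hj => by rw [(hM j hj).2, zero_smul]) (by simp)
    · rw [if_neg hik, map_zero, (hM k (Ne.symm hik)).1, zero_smul]

lemma a_adag_vac (F : FermionRep n H) (i j : Fin n) :
    F.a i (F.adag j F.vac) = if i = j then F.vac else 0 := by
  rw [a_adag_apply, F.a_vac, map_zero, sub_zero]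

/-! ### Operators local to at most one site -/

lemma monomial_empty (F : FermionRep n H) : F.monomial ∅ ∅ = 1 := by
  simp [monomial]

lemma monomial_singleton (F : FermionRep n H) (i : Fin n) :
    F.monomial {i} {i} = F.number i := by
  simp [monomial, number]

lemma localOps_empty (F : FermionRep n H) : F.localOps ∅ = Submodule.span ℂ {1} := by
  rw [localOps]
  congr 1
  ext X
  constructor
  · rintro ⟨A, B, hA, hB, -, rfl⟩
    rw [Finset.subset_empty] at hA hB
    subst hA hB
    exact F.monomial_empty
  · rintro rfl
    exact ⟨∅, ∅, subset_rfl, subset_rfl, by simp, F.monomial_empty.symm⟩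

lemma localOps_singleton (F : FermionRep n H) (i : Fin n) :
    F.localOps {i} = Submodule.span ℂ {1, F.number i} := by
  rw [localOps]
  congr 1
  ext X
  constructor
  · rintro ⟨A, B, hA, hB, hE, rfl⟩
    rcases Finset.subset_singleton_iff.mp hA with rfl | rfl <;>
      rcases Finset.subset_singleton_iff.mp hB with rfl | rfl
    · exact Or.inl F.monomial_empty
    -- A lone `aᵢ` or `aᵢ†` is odd, hence excluded.
    · simp at hE
    · simp at hE
    · exact Or.inr (F.monomial_singleton i)
  · rintro (rfl | rfl)
    · exact ⟨∅, ∅, by simp, by simp, by simp, F.monomial_empty.symm⟩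
    · exact ⟨{i}, {i}, subset_rfl, subset_rfl, by simp, (F.monomial_singleton i).symm⟩

lemma isExtensivelyLocal_singleton_iff (F : FermionRep n H) (i : Fin n) (O : Module.End ℂ H) :
    F.IsExtensivelyLocal {i} O ↔ O ∈ F.localOps {i} ∧ O ∉ F.localOps ∅ := by
  simp [IsExtensivelyLocal, Finset.ssubset_singleton_iff]

/-- `nᵢ` is not a scalar: it has eigenvalue `0` on the vacuum and `1` on `aᵢ†|0⟩`. -/
lemma number_notMem_localOps_empty (F : FermionRep n H) (i : Fin n) :
    F.number i ∉ F.localOps ∅ := by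
  rw [localOps_empty, Submodule.mem_span_singleton]
  rintro ⟨c, hc⟩
  have h0 : c • F.vac = 0 := (LinearMap.congr_fun hc F.vac).trans (F.number_vac i)
  obtain rfl : c = 0 := (smul_eq_zero.mp h0).resolve_right F.vac_ne_zero
  have h1 := LinearMap.congr_fun hc (F.adag i F.vac)
  rw [number_adag_apply, number_vac] at h1
  have h2 := congrArg (F.a i) h1
  simp [a_adag_vac, F.vac_ne_zero.symm] at h2

/-- If some operator `α + β nᵢ` with `β ≠ 0` is quasi-Hermitian for the total metric, then the
`i`-th column of the reduced metric is diagonal. -/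
lemma IsTotalMetric.column_eq_zero {F : FermionRep n H} {M : Matrix (Fin n) (Fin n) ℂ}
    {η : Module.End ℂ H} (h : F.IsTotalMetric M η) {i : Fin n} {α β : ℂ} (hβ : β ≠ 0)
    (hO : IsQuasiHermitian η (α • 1 + β • F.number i)) {j : Fin n} (hj : j ≠ i) :
    M j i = 0 := by
  have adj : LinearMap.adjoint (α • (1 : Module.End ℂ H) + β • F.number i)
      = star α • (1 : Module.End ℂ H) + star β • F.number i := by
    rw [← LinearMap.star_eq_adjoint, star_add, star_smul, star_smul, star_one,
      LinearMap.star_eq_adjoint, adjoint_number]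
  rw [IsQuasiHermitian, adj] at hO
  -- On the vacuum `nᵢ` vanishes and `η` is the identity, so only `α` is seen.
  have hα : α = star α := by
    have h0 := LinearMap.congr_fun hO F.vac
    simp only [Module.End.mul_apply, LinearMap.add_apply, LinearMap.smul_apply,
      Module.End.one_apply, number_vac, smul_zero, add_zero, map_smul, h.2] at h0
    exact smul_left_injective ℂ F.vac_ne_zero h0
  rw [← hα] at hO
  have hn : F.number i (F.adag i F.vac) = F.adag i F.vac := by
    rw [number_adag_apply, number_vac, map_zero, zero_add, if_pos rfl]
  have ha : F.a j (η (F.adag i F.vac)) = M j i • F.vac := by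
    rw [h.adag_apply, h.2, map_sum]
    simp [a_adag_vac]
  -- On the left `nᵢ` acts before `η`, with eigenvalue `1`. On the right it acts after `η`, but `aⱼ`
  -- commutes with it and leaves a multiple of the vacuum, which it kills. So `star β` drops out,
  -- and `β` need not be known to be real.
  have h1 := congrArg (F.a j) (LinearMap.congr_fun hO (F.adag i F.vac))
  simp only [Module.End.mul_apply, LinearMap.add_apply, LinearMap.smul_apply,
    Module.End.one_apply, hn, map_add, map_smul, F.a_number_apply_of_ne hj, ha, number_vac,
    smul_zero, add_zero, add_eq_left] at h1
  simpa [hβ, F.vac_ne_zero] using h1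

end FermionRep

theorem corollary6 {n : ℕ} {H : Type*} [NormedAddCommGroup H] [InnerProductSpace ℂ H]
    [FiniteDimensional ℂ H] (F : FermionRep n H) (M : Matrix (Fin n) (Fin n) ℂ) (hM : M.PosDef)
    (i : Fin n) :
    (∃ O : Module.End ℂ H,
        IsQuasiHermitian (F.totalMetric M) O ∧ F.IsExtensivelyLocal {i} O) ↔
      ∀ j : Fin n, j ≠ i → M i j = 0 ∧ M j i = 0 := by
  have hη := F.isTotalMetric_totalMetric M
  constructor
  · rintro ⟨O, hO, hloc⟩ j hj
    rw [F.isExtensivelyLocal_singleton_iff, F.localOps_singleton, F.localOps_empty,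
      Submodule.mem_span_pair, Submodule.mem_span_singleton] at hloc
    obtain ⟨⟨α, β, rfl⟩, hne⟩ := hloc
    -- For `β = 0` the operator would be a scalar, already local to `∅`.
    have hβ : β ≠ 0 := by
      rintro rfl
      exact hne ⟨α, by simp⟩
    have hji := hη.column_eq_zero hβ hO hj
    exact ⟨by rw [← hM.isHermitian.apply, hji, star_zero], hji⟩
  · intro h
    refine ⟨F.number i, ?_, (F.isExtensivelyLocal_singleton_iff i _).mpr
      ⟨?_, F.number_notMem_localOps_empty i⟩⟩
    -- As `nᵢ` is self-adjoint, quasi-Hermiticity is just commutation with `η`.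
    · rw [IsQuasiHermitian, F.adjoint_number]
      exact hη.commute_number h
    · rw [F.localOps_singleton]
      exact Submodule.subset_span (by simp)
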